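/- Let $k$ be a field, $L/k$ a finite Galois extension with Galois group $G=\mathrm{Gal}(L/k)$, and let $\alpha\colon G\times G\to L^*$ be a 2-cocycle (for the Galois action of $G$ on $L^*$) whose class in $H^2(G,L^*)$ has order $m$. Suppose that $\mathrm{char}\,k=0$, or that $\mathrm{char}\,k=p>0$ and $p\nmid m$. For a finite Galois extension $K/k$ with group $N=\mathrm{Gal}(K/k)$ and a 2-cocycle $\beta\colon N\times N\to K^*$, let $K^{\beta}_tN$ denote the crossed product algebra: the central simple $k$-algebra with $K$-basis $\{U_g\}_{g\in N}$ and multiplication $(xU_g)(yU_h)=x\,g(y)\,\beta(g,h)\,U_{gh}$ for $x,y\in K$ and $g,h\in N$. Then there exist a finite Galois extension $K/k$ containing $L$ and, with $N=\mathrm{Gal}(K/k)$, a 2-cocycle $\beta\colon N\times N\to K^*$ all of whose values are $m$-th roots of unity (so $\beta$ is finite, that is, all its values are roots of unity), such that the crossed product algebras $L^{\alpha}_tG$ and $K^{\beta}_tN$ are Brauer equivalent over $k$. -/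

import Mathlib

universe u v

section Cohomology

variable (G : Type u) (M : Type v) [Group G] [CommGroup M] [MulDistribMulAction G M]

/-- The group `Z²(G, M)` of 2-cocycles of `G` with values in the (multiplicatively written)
`G`-module `M`, under pointwise multiplication. -/
def TwoCocycles : Subgroup (G × G → M) where
  carrier := {f | groupCohomology.IsMulCocycle₂ f}
  one_mem' := fun g h j => by simp
  mul_mem' := fun {a b} ha hb g h j => by
    have h1 := ha g h j
    have h2 := hb g h j
    simp only [Pi.mul_apply, smul_mul']
    rw [mul_mul_mul_comm, h1, h2, mul_mul_mul_comm]
  inv_mem' := fun {a} ha g h j => by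
    have h1 := ha g h j
    simp only [Pi.inv_apply, smul_inv']
    rw [← mul_inv, h1, mul_inv]

/-- The group `B²(G, M)` of 2-coboundaries of `G` with values in `M`. -/
def TwoCoboundaries : Subgroup (G × G → M) where
  carrier := {f | groupCohomology.IsMulCoboundary₂ f}
  one_mem' := ⟨1, fun g h => by simp⟩
  mul_mem' := by
    rintro a b ⟨x, hx⟩ ⟨y, hy⟩
    refine ⟨x * y, fun g h => ?_⟩
    simp only [Pi.mul_apply, smul_mul', ← hx, ← hy]
    rw [mul_div_mul_comm, mul_mul_mul_comm]
  inv_mem' := by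
    rintro a ⟨x, hx⟩
    refine ⟨x⁻¹, fun g h => ?_⟩
    simp only [Pi.inv_apply, smul_inv', ← hx, mul_inv, inv_div_inv, inv_div]

/-- The second cohomology group `H²(G, M) = Z²(G, M) / B²(G, M)`. -/
abbrev SecondCohomology : Type _ :=
  TwoCocycles G M ⧸ (TwoCoboundaries G M).subgroupOf (TwoCocycles G M)

variable {G M}

/-- The cohomology class of a 2-cocycle. -/
def cohomologyClass (α : TwoCocycles G M) : SecondCohomology G M :=
  QuotientGroup.mk α

/-- A cocycle is finite if all its values are roots of unity (elements of finite order). -/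
def IsFiniteCocycle (α : TwoCocycles G M) : Prop :=
  ∀ g h : G, IsOfFinOrder (α.1 (g, h))

end Cohomology

section CrossedProduct

variable {k : Type u} {L : Type v} [Field k] [Field L] [Algebra k L]

/-- The crossed product algebra of the extension `L / k` with group `G = Gal(L/k)` and a 2-cocycle
`α ∈ Z²(G, Lˣ)`. As an `L`-vector space it has the basis `U_g` (`g ∈ G`), where `x U_g` is
`Finsupp.single g x`. -/
def CrossedProduct (_α : TwoCocycles Gal(L/k) Lˣ) : Type v := Gal(L/k) →₀ L

namespace CrossedProduct

variable (α : TwoCocycles Gal(L/k) Lˣ)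

noncomputable instance : AddCommGroup (CrossedProduct α) :=
  inferInstanceAs (AddCommGroup (Gal(L/k) →₀ L))

noncomputable instance : Module L (CrossedProduct α) :=
  inferInstanceAs (Module L (Gal(L/k) →₀ L))

noncomputable instance : Module k (CrossedProduct α) :=
  inferInstanceAs (Module k (Gal(L/k) →₀ L))

/-- The element `x U_g`. -/
noncomputable def of (g : Gal(L/k)) (x : L) : CrossedProduct α := Finsupp.single g x

/-- The coefficient of `U_g`. -/
def coeff (a : CrossedProduct α) (g : Gal(L/k)) : L := (show Gal(L/k) →₀ L from a) g

/-- The bilinear extension of `(x U_g) (y U_h) = x g(y) α(g, h) U_{gh}`. -/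
noncomputable def mulFun (a b : Gal(L/k) →₀ L) : Gal(L/k) →₀ L :=
  a.sum fun g x => b.sum fun h y => Finsupp.single (g * h) (x * g y * (α.1 (g, h) : L))

noncomputable instance : Mul (CrossedProduct α) where
  mul := mulFun α

/-- The unit is `α(1, 1)⁻¹ U_1` (cocycles need not be normalized). -/
noncomputable instance : One (CrossedProduct α) where
  one := of α 1 ((α.1 (1, 1))⁻¹ : Lˣ)

theorem of_add (g : Gal(L/k)) (x y : L) : of α g (x + y) = of α g x + of α g y :=
  Finsupp.single_add g x y

theorem of_zero (g : Gal(L/k)) : of α g 0 = 0 := Finsupp.single_zero g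

theorem smul_of (c : k) (g : Gal(L/k)) (x : L) : c • of α g x = of α g (c • x) :=
  Finsupp.smul_single c g x

theorem coeff_add (a b : CrossedProduct α) (g : Gal(L/k)) :
    coeff α (a + b) g = coeff α a g + coeff α b g := rfl

theorem coeff_sub (a b : CrossedProduct α) (g : Gal(L/k)) :
    coeff α (a - b) g = coeff α a g - coeff α b g := rfl

theorem coeff_zero (g : Gal(L/k)) : coeff α 0 g = 0 := rfl

theorem coeff_of_same (g : Gal(L/k)) (x : L) : coeff α (of α g x) g = x :=
  Finsupp.single_eq_same

theorem coeff_of_ne {g h : Gal(L/k)} (hgh : h ≠ g) (x : L) : coeff α (of α g x) h = 0 :=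
  Finsupp.single_eq_of_ne hgh

theorem ext_coeff {a b : CrossedProduct α} (h : ∀ g, coeff α a g = coeff α b g) : a = b :=
  Finsupp.ext h

theorem induction_of {p : CrossedProduct α → Prop} (a : CrossedProduct α) (h0 : p 0)
    (hadd : ∀ a b, p a → p b → p (a + b)) (hof : ∀ g x, p (of α g x)) : p a :=
  Finsupp.induction_linear (motive := p) a h0 hadd hof

theorem add_mulFun (a b c : Gal(L/k) →₀ L) : mulFun α (a + b) c = mulFun α a c + mulFun α b c := by
  refine Finsupp.sum_add_index' (fun g => ?_) (fun g x y => ?_)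
  · simp
  · rw [← Finsupp.sum_add]
    exact Finsupp.sum_congr fun h _ => by rw [← Finsupp.single_add]; ring_nf

theorem mulFun_add (a b c : Gal(L/k) →₀ L) : mulFun α a (b + c) = mulFun α a b + mulFun α a c := by
  rw [mulFun, mulFun, mulFun, ← Finsupp.sum_add]
  refine Finsupp.sum_congr fun g _ => Finsupp.sum_add_index' (fun h => ?_) (fun h x y => ?_)
  · simp
  · rw [← Finsupp.single_add, map_add]; ring_nf

theorem mulFun_zero (a : Gal(L/k) →₀ L) : mulFun α a 0 = 0 := by
  simp [mulFun]

theorem zero_mulFun (a : Gal(L/k) →₀ L) : mulFun α 0 a = 0 := by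
  simp [mulFun]

theorem mulFun_single_single (g h : Gal(L/k)) (x y : L) :
    mulFun α (Finsupp.single g x) (Finsupp.single h y) =
      Finsupp.single (g * h) (x * g y * (α.1 (g, h) : L)) := by
  refine (Finsupp.sum_single_index ?_).trans (Finsupp.sum_single_index ?_) <;> simp

theorem add_mul_aux (a b c : CrossedProduct α) : (a + b) * c = a * c + b * c :=
  add_mulFun α a b c

theorem mul_add_aux (a b c : CrossedProduct α) : a * (b + c) = a * b + a * c :=
  mulFun_add α a b c

theorem zero_mul_aux (a : CrossedProduct α) : 0 * a = 0 := zero_mulFun α a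

theorem mul_zero_aux (a : CrossedProduct α) : a * 0 = 0 := mulFun_zero α a

/-- The defining multiplication rule of the crossed product. -/
theorem of_mul_of (g h : Gal(L/k)) (x y : L) :
    of α g x * of α h y = of α (g * h) (x * g y * (α.1 (g, h) : L)) :=
  mulFun_single_single α g h x y

theorem cocycle_apply (g h j : Gal(L/k)) :
    (α.1 (g * h, j) : L) * (α.1 (g, h) : L) = g (α.1 (h, j) : L) * (α.1 (g, h * j) : L) := by
  have := congrArg (Units.val) (α.2 g h j)
  simpa using this

theorem cocycle_one_left (g : Gal(L/k)) : α.1 (1, g) = α.1 (1, 1) :=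
  groupCohomology.map_one_fst_of_isMulCocycle₂ α.2 g

theorem cocycle_one_right (g : Gal(L/k)) : (α.1 (g, 1) : L) = g (α.1 (1, 1) : L) := by
  simpa using congrArg Units.val (groupCohomology.map_one_snd_of_isMulCocycle₂ α.2 g)

theorem one_def : (1 : CrossedProduct α) = of α 1 ((α.1 (1, 1))⁻¹ : Lˣ) := rfl

noncomputable instance : Ring (CrossedProduct α) where
  __ := (inferInstance : AddCommGroup (CrossedProduct α))
  left_distrib := mul_add_aux α
  right_distrib := add_mul_aux α
  zero_mul := zero_mul_aux α
  mul_zero := mul_zero_aux α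
  mul_assoc a b c := by
    induction a using induction_of α with
    | h0 => simp only [zero_mul_aux]
    | hadd a a' ha ha' => simp only [add_mul_aux, ha, ha']
    | hof g x =>
      induction b using induction_of α with
      | h0 => simp only [zero_mul_aux, mul_zero_aux]
      | hadd b b' hb hb' => simp only [add_mul_aux, mul_add_aux, hb, hb']
      | hof h y =>
        induction c using induction_of α with
        | h0 => simp only [mul_zero_aux]
        | hadd c c' hc hc' => simp only [mul_add_aux, hc, hc']
        | hof j z =>
          simp only [of_mul_of, mul_assoc, map_mul, AlgEquiv.mul_apply]
          rw [← cocycle_apply]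
          ring_nf
  one_mul a := by
    induction a using induction_of α with
    | h0 => simp only [mul_zero_aux]
    | hadd a b ha hb => simp only [mul_add_aux, ha, hb]
    | hof g x =>
      rw [one_def, of_mul_of, cocycle_one_left α g, one_mul, AlgEquiv.one_apply, mul_right_comm]
      simp
  mul_one a := by
    induction a using induction_of α with
    | h0 => simp only [zero_mul_aux]
    | hadd a b ha hb => simp only [add_mul_aux, ha, hb]
    | hof g x =>
      rw [one_def, of_mul_of, cocycle_one_right, mul_one, mul_assoc, ← map_mul]
      simp

theorem smul_mul_aux (c : k) (a b : CrossedProduct α) : (c • a) * b = c • (a * b) := by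
  induction a using induction_of α with
  | h0 => simp
  | hadd a a' ha ha' => simp only [smul_add, add_mul, ha, ha']
  | hof g x =>
    induction b using induction_of α with
    | h0 => simp
    | hadd b b' hb hb' => simp only [mul_add, smul_add, hb, hb']
    | hof h y => simp only [smul_of, of_mul_of, smul_mul_assoc]

theorem mul_smul_aux (c : k) (a b : CrossedProduct α) : a * (c • b) = c • (a * b) := by
  induction a using induction_of α with
  | h0 => simp
  | hadd a a' ha ha' => simp only [smul_add, add_mul, ha, ha']
  | hof g x =>
    induction b using induction_of α with
    | h0 => simp
    | hadd b b' hb hb' => simp only [mul_add, smul_add, hb, hb']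
    | hof h y => simp only [smul_of, of_mul_of, map_smul, smul_mul_assoc, mul_smul_comm]

noncomputable instance : Algebra k (CrossedProduct α) :=
  Algebra.ofModule (smul_mul_aux α) (mul_smul_aux α)

/-- The copy of the element `x ∈ L` in the crossed product, that is `x · 1`. -/
noncomputable def scalar (x : L) : CrossedProduct α := of α 1 (x * ((α.1 (1, 1))⁻¹ : Lˣ))

theorem scalar_mul_of (x y : L) (g : Gal(L/k)) : scalar α x * of α g y = of α g (x * y) := by
  rw [scalar, of_mul_of, cocycle_one_left α g, one_mul, AlgEquiv.one_apply]
  congr 1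
  rw [mul_right_comm, mul_assoc x]
  simp

theorem of_mul_scalar (x y : L) (g : Gal(L/k)) : of α g y * scalar α x = of α g (y * g x) := by
  rw [scalar, of_mul_of, cocycle_one_right, mul_one, mul_assoc, ← map_mul]
  simp

theorem coeff_scalar_mul (x : L) (a : CrossedProduct α) (g : Gal(L/k)) :
    coeff α (scalar α x * a) g = x * coeff α a g := by
  induction a using induction_of α with
  | h0 => simp [coeff_zero]
  | hadd a b ha hb => rw [mul_add, coeff_add, coeff_add, ha, hb, mul_add]
  | hof h y =>
    rw [scalar_mul_of]
    by_cases hgh : g = h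
    · subst hgh; simp only [coeff_of_same]
    · simp only [coeff_of_ne α hgh, mul_zero]

theorem coeff_mul_scalar (x : L) (a : CrossedProduct α) (g : Gal(L/k)) :
    coeff α (a * scalar α x) g = coeff α a g * g x := by
  induction a using induction_of α with
  | h0 => simp [coeff_zero]
  | hadd a b ha hb => rw [add_mul, coeff_add, coeff_add, ha, hb, add_mul]
  | hof h y =>
    rw [of_mul_scalar]
    by_cases hgh : g = h
    · subst hgh; simp only [coeff_of_same]
    · simp only [coeff_of_ne α hgh, zero_mul]

theorem of_inv_mul_of (g : Gal(L/k)) (x : L) (hx : x ≠ 0) :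
    ∃ b : CrossedProduct α, b * of α g x = 1 := by
  refine ⟨of α g⁻¹ (((α.1 (1, 1))⁻¹ : Lˣ) * (g⁻¹ x)⁻¹ * ((α.1 (g⁻¹, g))⁻¹ : Lˣ)), ?_⟩
  rw [of_mul_of, one_def, inv_mul_cancel]
  congr 1
  have : g⁻¹ x ≠ 0 := by simpa using hx
  simp only [Units.val_inv_eq_inv_val]
  field_simp

instance : Nontrivial (CrossedProduct α) :=
  inferInstanceAs (Nontrivial (Gal(L/k) →₀ L))

instance [FiniteDimensional k L] : FiniteDimensional k (CrossedProduct α) :=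
  inferInstanceAs (FiniteDimensional k (Gal(L/k) →₀ L))

theorem mem_of_ne_zero (I : TwoSidedIdeal (CrossedProduct α)) (n : ℕ) :
    ∀ a : CrossedProduct α, a ∈ I → a ≠ 0 →
      (show Gal(L/k) →₀ L from a).support.card ≤ n → (1 : CrossedProduct α) ∈ I := by
  induction n with
  | zero =>
    intro a _ ha0 hc
    refine absurd ?_ ha0
    exact Finsupp.support_eq_empty.1 (Finset.card_eq_zero.1 (Nat.le_zero.1 hc))
  | succ n ih =>
    intro a ha ha0 hc
    obtain ⟨h, hh⟩ : ∃ h, coeff α a h ≠ 0 := by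
      by_contra hcon
      push Not at hcon
      exact ha0 (ext_coeff α hcon)
    by_cases hone : ∀ g, g ≠ h → coeff α a g = 0
    · have hah : a = of α h (coeff α a h) := by
        refine ext_coeff α fun g => ?_
        by_cases hg : g = h
        · subst hg; rw [coeff_of_same]
        · rw [hone g hg, coeff_of_ne α hg]
      obtain ⟨b, hb⟩ := of_inv_mul_of α h _ hh
      rw [← hb, ← hah]
      exact I.mul_mem_left _ _ ha
    · push Not at hone
      obtain ⟨g, hgh, hg⟩ := hone
      obtain ⟨x, hx⟩ : ∃ x, g x ≠ h x := by
        by_contra hcon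
        push Not at hcon
        exact hgh (AlgEquiv.ext hcon)
      have hco : ∀ s, coeff α (a * scalar α x - scalar α (h x) * a) s
          = coeff α a s * (s x - h x) := fun s => by
        rw [coeff_sub, coeff_mul_scalar, coeff_scalar_mul]; ring
      refine ih (a * scalar α x - scalar α (h x) * a)
        (I.sub_mem (I.mul_mem_right _ _ ha) (I.mul_mem_left _ _ ha)) (fun h0 => ?_) ?_
      · have := hco g
        rw [h0, coeff_zero] at this
        exact mul_ne_zero hg (sub_ne_zero.2 hx) this.symm
      · refine Nat.le_of_lt_succ (lt_of_lt_of_le (Finset.card_lt_card ?_) hc)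
        refine (Finset.ssubset_iff_of_subset fun s hs => ?_).2 ⟨h, ?_, ?_⟩
        · have hs' : coeff α (a * scalar α x - scalar α (h x) * a) s ≠ 0 :=
            Finsupp.mem_support_iff.1 hs
          rw [hco] at hs'
          exact Finsupp.mem_support_iff.2 (left_ne_zero_of_mul hs')
        · exact Finsupp.mem_support_iff.2 hh
        · refine Finsupp.notMem_support_iff.2 ((hco h).trans ?_)
          rw [sub_self, mul_zero]

instance : IsSimpleRing (CrossedProduct α) :=
  IsSimpleRing.of_eq_bot_or_eq_top fun I => by
    by_cases hI : I = ⊥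
    · exact Or.inl hI
    · right
      obtain ⟨a, ha, ha0⟩ : ∃ a ∈ I, a ≠ 0 := by
        by_contra hcon
        push Not at hcon
        refine hI (le_bot_iff.1 fun a ha => ?_)
        rw [hcon a ha]
        exact TwoSidedIdeal.zero_mem _
      exact I.one_mem_iff.1 (mem_of_ne_zero α I _ a ha ha0 le_rfl)

instance [IsGalois k L] : Algebra.IsCentral k (CrossedProduct α) where
  out := fun z hz => by
    rw [Subalgebra.mem_center_iff] at hz
    have hz1 : ∀ g, g ≠ 1 → coeff α z g = 0 := by
      intro g hg
      obtain ⟨x, hx⟩ : ∃ x, g x ≠ x := by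
        by_contra hcon
        push Not at hcon
        exact hg (AlgEquiv.ext hcon)
      have := congrArg (fun a => coeff α a g) (hz (scalar α x))
      simp only [coeff_scalar_mul, coeff_mul_scalar] at this
      by_contra h0
      rw [mul_comm] at this
      exact hx (mul_left_cancel₀ h0 this).symm
    obtain ⟨y, hy⟩ : ∃ y, z = scalar α y := by
      refine ⟨coeff α z 1 * (α.1 (1, 1) : L), ext_coeff α fun g => ?_⟩
      by_cases hg : g = 1
      · subst hg
        rw [scalar, coeff_of_same]
        simp
      · rw [hz1 g hg, scalar, coeff_of_ne α hg]
    subst hy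
    have hfix : ∀ g : Gal(L/k), g y = y := by
      intro g
      have := congrArg (fun a => coeff α a g) (hz (of α g 1))
      simpa only [scalar_mul_of, of_mul_scalar, coeff_of_same, one_mul, mul_one] using this
    obtain ⟨c, rfl⟩ := (InfiniteGalois.mem_range_algebraMap_iff_fixed y).2 hfix
    refine Algebra.mem_bot.2 ⟨c, ?_⟩
    rw [Algebra.algebraMap_eq_smul_one, one_def, smul_of, scalar, Algebra.smul_def]

/-- The crossed product of a finite Galois extension, as a central simple algebra. -/
noncomputable def csa [FiniteDimensional k L] [IsGalois k L] : CSA.{u, v} k where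
  toAlgCat := AlgCat.of k (CrossedProduct α)
  isCentral := inferInstanceAs (Algebra.IsCentral k (CrossedProduct α))
  isSimple := inferInstanceAs (IsSimpleRing (CrossedProduct α))
  fin_dim := inferInstanceAs (FiniteDimensional k (CrossedProduct α))

end CrossedProduct

end CrossedProduct

/-!
If the class of `α` has order `m`, then `α ^ m` is the coboundary of some `c : G → Lˣ`. As `m` is
invertible in `k`, the polynomials `X ^ m - c g` are separable, so a finite Galois extension `K / k`
containing `L` has `m`-th roots of all values of `c`. Dividing the inflation of `α` to `Gal(K/k)`
by the coboundary of these roots gives a cohomologous cocycle `β` with `β ^ m = 1`.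

Cohomologous cocycles have isomorphic crossed products, by rescaling the basis `U_g`. Inflation
does not change the Brauer class: the crossed product of the inflated cocycle acts on
`K ⊗[L] CrossedProduct α`, commuting with the right action of `CrossedProduct α`. This gives a
homomorphism to the matrices of size `[K : L]` over `CrossedProduct α`, which is injective because
crossed products are simple, and bijective by a comparison of dimensions.
-/

section Cohomology

variable {G H M N : Type*} [Group G] [Group H] [CommGroup M] [CommGroup N]
  [MulDistribMulAction G M] [MulDistribMulAction H N]

namespace TwoCocycles

/-- The 2-coboundary `(g, h) ↦ g • x h / x (g * h) * x g` of a 1-cochain `x`, as a homomorphism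
into the group of 2-cocycles. -/
def coboundary : (G → M) →* TwoCocycles G M where
  toFun x := ⟨fun p => p.1 • x p.2 / x (p.1 * p.2) * x p.1, fun g h j => by
    apply Additive.ofMul.injective
    simp only [smul_mul', smul_div', mul_smul, mul_assoc, ofMul_mul, ofMul_div]
    abel⟩
  map_one' := by
    ext p
    simp
  map_mul' x y := by
    ext p
    simp only [Pi.mul_apply, smul_mul', mul_div_mul_comm, mul_mul_mul_comm, Subgroup.coe_mul]

theorem coboundary_apply (x : G → M) (g h : G) :
    (coboundary x).1 (g, h) = g • x h / x (g * h) * x g := rfl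

theorem coboundary_apply_one_one (x : G → M) : (coboundary x).1 (1, 1) = x 1 := by
  rw [coboundary_apply, one_smul, one_mul, div_self', one_mul]

theorem coboundary_eq_iff {x : G → M} {α : TwoCocycles G M} :
    coboundary x = α ↔ ∀ g h, g • x h / x (g * h) * x g = α.1 (g, h) := by
  rw [Subtype.ext_iff, funext_iff, Prod.forall]
  rfl

theorem cohomologyClass_eq_iff {α β : TwoCocycles G M} :
    cohomologyClass α = cohomologyClass β ↔ ∃ x, coboundary x * α = β := by
  simp_rw [← eq_mul_inv_iff_mul_eq, mul_comm β, coboundary_eq_iff]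
  exact QuotientGroup.eq (s := (TwoCoboundaries G M).subgroupOf (TwoCocycles G M))

theorem cohomologyClass_eq_one_iff {α : TwoCocycles G M} :
    cohomologyClass α = 1 ↔ ∃ x, coboundary x = α := by
  simp only [coboundary_eq_iff]
  exact QuotientGroup.eq_one_iff α

theorem cohomologyClass_pow (α : TwoCocycles G M) (m : ℕ) :
    cohomologyClass (α ^ m) = cohomologyClass α ^ m := rfl

theorem coboundary_prod_eq_pow_card [Fintype G] (α : TwoCocycles G M) :
    coboundary (fun g => ∏ j, α.1 (g, j)) = α ^ Fintype.card G := by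
  refine coboundary_eq_iff.2 fun g h => ?_
  have prod_cocycle : (∏ j, α.1 (g * h, j)) * α.1 (g, h) ^ Fintype.card G =
      (g • ∏ j, α.1 (h, j)) * ∏ j, α.1 (g, j) := by
    rw [← Equiv.prod_comp (Equiv.mulLeft h) fun j => α.1 (g, j), Finset.smul_prod',
      ← Finset.card_univ, ← Finset.prod_const, ← Finset.prod_mul_distrib, ← Finset.prod_mul_distrib]
    exact Finset.prod_congr rfl fun j _ => α.2 g h j
  rw [div_mul_eq_mul_div, ← prod_cocycle, mul_div_cancel_left]
  rfl

theorem isOfFinOrder_cohomologyClass [Finite G] (α : TwoCocycles G M) :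
    IsOfFinOrder (cohomologyClass α) := by
  have := Fintype.ofFinite G
  refine isOfFinOrder_iff_pow_eq_one.2 ⟨Fintype.card G, Fintype.card_pos, ?_⟩
  rw [← cohomologyClass_pow, cohomologyClass_eq_one_iff]
  exact ⟨_, coboundary_prod_eq_pow_card α⟩

theorem exists_cohomologyClass_eq_pow_eq_one {α : TwoCocycles G M} {x : G → M} {m : ℕ}
    (hx : coboundary (x ^ m) = α ^ m) :
    ∃ β : TwoCocycles G M, cohomologyClass α = cohomologyClass β ∧ β ^ m = 1 := by
  refine ⟨coboundary x⁻¹ * α, cohomologyClass_eq_iff.2 ⟨_, rfl⟩, ?_⟩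
  rw [mul_pow, ← map_pow, inv_pow, map_inv, hx, inv_mul_cancel]

/-- The pullback of 2-cocycles along a homomorphism `φ : H →* G` and an equivariant homomorphism
`f : M →* N` of coefficients. -/
def map (φ : H →* G) (f : M →* N) (hf : ∀ h x, f (φ h • x) = h • f x) :
    TwoCocycles G M →* TwoCocycles H N where
  toFun α := ⟨fun p => f (α.1 (φ p.1, φ p.2)), fun g h j => by
    simp only [map_mul φ, ← hf, ← map_mul f, α.2 (φ g) (φ h) (φ j)]⟩
  map_one' := Subtype.ext (funext fun _ => map_one f)
  map_mul' _ _ := Subtype.ext (funext fun _ => map_mul f _ _)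

theorem map_coboundary (φ : H →* G) (f : M →* N) (hf : ∀ h x, f (φ h • x) = h • f x)
    (x : G → M) : map φ f hf (coboundary x) = coboundary fun h => f (x (φ h)) := by
  refine (coboundary_eq_iff.2 fun g h => ?_).symm
  simp only [map, coboundary_apply, MonoidHom.coe_mk, OneHom.coe_mk, map_mul, map_div, hf]

end TwoCocycles

end Cohomology

section FieldExtension

variable {k : Type u} {L : Type v} [Field k] [Field L] [Algebra k L]

open Polynomial in
theorem exists_isGalois_forall_aeval_eq_zero [FiniteDimensional k L] [Algebra.IsSeparable k L]
    {ι : Type*} [Finite ι] (f : ι → L[X]) (hsep : ∀ i, (f i).Separable)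
    (hdeg : ∀ i, (f i).degree ≠ 0) :
    ∃ (K : Type v) (_ : Field K) (_ : Algebra k K) (_ : Algebra L K) (_ : IsScalarTower k L K)
      (_ : FiniteDimensional k K) (_ : IsGalois k K), ∃ x : ι → K, ∀ i, aeval (x i) (f i) = 0 := by
  let Ω := SeparableClosure L
  have : Algebra.IsSeparable k Ω := Algebra.IsSeparable.trans k L Ω
  have : IsSepClosure k Ω := ⟨inferInstance, inferInstance⟩
  choose x hx using fun i => IsSepClosed.exists_aeval_eq_zero Ω (f i) (hdeg i) (hsep i)
  let F := IntermediateField.adjoin L (Set.range x)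
  have : FiniteDimensional L F :=
    IntermediateField.finiteDimensional_adjoin fun _ _ => Algebra.IsIntegral.isIntegral _
  have : FiniteDimensional k F := FiniteDimensional.trans k L F
  have : IsScalarTower k F Ω := IsScalarTower.of_algebraMap_eq fun _ => rfl
  let K := IntermediateField.normalClosure k F Ω
  let _ : Algebra L K := ((algebraMap F K).comp (algebraMap L F)).toAlgebra
  have : IsScalarTower L K Ω := IsScalarTower.of_algebraMap_eq fun _ => rfl
  have hxK (i : ι) : x i ∈ K :=
    IntermediateField.le_normalClosure (F.restrictScalars k)
      (IntermediateField.subset_adjoin L _ ⟨i, rfl⟩)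
  refine ⟨K, inferInstance, inferInstance, inferInstance,
    IsScalarTower.of_algebraMap_eq fun _ => rfl, inferInstance, inferInstance,
    fun i => ⟨x i, hxK i⟩, fun i => (algebraMap K Ω).injective ?_⟩
  rw [← aeval_algebraMap_apply, map_zero]
  exact hx i

theorem exists_isGalois_forall_pow_eq [FiniteDimensional k L] [Algebra.IsSeparable k L]
    {ι : Type*} [Finite ι] (c : ι → Lˣ) {m : ℕ} (hm : (m : k) ≠ 0) :
    ∃ (K : Type v) (_ : Field K) (_ : Algebra k K) (_ : Algebra L K) (_ : IsScalarTower k L K)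
      (_ : FiniteDimensional k K) (_ : IsGalois k K),
      ∃ d : ι → Kˣ, ∀ i, d i ^ m = Units.map (algebraMap L K) (c i) := by
  have hm0 : m ≠ 0 := by
    rintro rfl
    exact hm Nat.cast_zero
  have hmL : (m : L) ≠ 0 := by
    rw [← map_natCast (algebraMap k L)]
    exact (map_ne_zero _).2 hm
  obtain ⟨K, _, _, _, _, _, _, x, hx⟩ := exists_isGalois_forall_aeval_eq_zero (k := k)
    (fun i => Polynomial.X ^ m - Polynomial.C (c i : L))
    (fun i => Polynomial.separable_X_pow_sub_C _ hmL (c i).ne_zero)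
    (fun i => by
      rw [Polynomial.degree_X_pow_sub_C hm0.bot_lt]
      exact_mod_cast hm0)
  have hpow (i : ι) : x i ^ m = algebraMap L K (c i) := by
    simpa only [map_sub, map_pow, Polynomial.aeval_X, Polynomial.aeval_C, sub_eq_zero] using hx i
  have hx0 (i : ι) : x i ≠ 0 := by
    refine ne_zero_pow hm0 ?_
    rw [hpow]
    exact (map_ne_zero _).2 (c i).ne_zero
  exact ⟨K, inferInstance, inferInstance, inferInstance, inferInstance, inferInstance,
    inferInstance, fun i => Units.mk0 (x i) (hx0 i), fun i => Units.ext (hpow i)⟩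

end FieldExtension

section Algebra

variable {R A : Type*} [CommSemiring R] [Semiring A] [Algebra R A]

theorem basis_repr_algebraMap_mul {ι : Type*} (b : Module.Basis ι R A) (c : R) (x : A) (i : ι) :
    b.repr (algebraMap R A c * x) i = c * b.repr x i := by
  rw [← Algebra.smul_def, map_smul, Finsupp.smul_apply, smul_eq_mul]

variable (R A) in
theorem nonempty_matrix_fin_one_algEquiv : Nonempty (Matrix (Fin 1) (Fin 1) A ≃ₐ[R] A) := by
  convert Nonempty.intro (Matrix.uniqueAlgEquiv (m := Fin 1) (R := R) (A := A))

end Algebra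

namespace CrossedProduct

variable {k : Type u} {L : Type v} [Field k] [Field L] [Algebra k L]

theorem of_sum (α : TwoCocycles Gal(L/k) Lˣ) {κ : Type*} (s : Finset κ) (g : Gal(L/k))
    (f : κ → L) : of α g (∑ i ∈ s, f i) = ∑ i ∈ s, of α g (f i) :=
  map_sum (Finsupp.singleAddHom g) f s

theorem finrank_eq [FiniteDimensional k L] [IsGalois k L] (α : TwoCocycles Gal(L/k) Lˣ) :
    Module.finrank k (CrossedProduct α) = Module.finrank k L * Module.finrank k L := by
  have := Fintype.ofFinite Gal(L/k)
  refine (Module.finrank_finsupp k L (ι := Gal(L/k))).trans ?_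
  rw [← Nat.card_eq_fintype_card, IsGalois.card_aut_eq_finrank]

section Lift

variable (α : TwoCocycles Gal(L/k) Lˣ) {A : Type*} [Ring A] [Algebra k A]
  (φ : Gal(L/k) → L →ₗ[k] A) (hone : φ 1 ((α.1 (1, 1))⁻¹ : Lˣ) = 1)
  (hmul : ∀ g h x y, φ g x * φ h y = φ (g * h) (x * g y * (α.1 (g, h) : L)))

/-- The homomorphism `x U_g ↦ φ g x` from a crossed product to an algebra `A`, for linear maps
`φ g : L → A` that respect the unit and the multiplication rule. -/
noncomputable def lift : CrossedProduct α →ₐ[k] A :=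
  let f : CrossedProduct α →ₗ[k] A := Finsupp.lsum k φ
  have f_of (g : Gal(L/k)) (x : L) : f (of α g x) = φ g x := Finsupp.lsum_single k φ g x
  AlgHom.ofLinearMap f ((f_of _ _).trans hone) fun a b => by
    induction a using induction_of α with
    | h0 => simp only [zero_mul, map_zero]
    | hadd a a' ha ha' => simp only [add_mul, map_add, ha, ha']
    | hof g x =>
      induction b using induction_of α with
      | h0 => simp only [mul_zero, map_zero]
      | hadd b b' hb hb' => simp only [mul_add, map_add, hb, hb']
      | hof h y => rw [of_mul_of, f_of, f_of, f_of, hmul]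

theorem lift_of (g : Gal(L/k)) (x : L) : lift α φ hone hmul (of α g x) = φ g x :=
  Finsupp.lsum_single k φ g x

end Lift

/-- The `k`-linear map `x ↦ x U_g`. -/
noncomputable def ofLinearMap (α : TwoCocycles Gal(L/k) Lˣ) (g : Gal(L/k)) :
    L →ₗ[k] CrossedProduct α where
  toFun := of α g
  map_add' := of_add α g
  map_smul' c x := (smul_of α c g x).symm

section Cohomologous

variable (α : TwoCocycles Gal(L/k) Lˣ) (e : Gal(L/k) → Lˣ)

theorem coboundary_mul_apply (g h : Gal(L/k)) :
    ((TwoCocycles.coboundary e * α).1 (g, h) : L) * e (g * h) = e g * g (e h) * α.1 (g, h) := by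
  have : (TwoCocycles.coboundary e * α).1 (g, h) * e (g * h) = e g * g • e h * α.1 (g, h) := by
    rw [Subgroup.coe_mul, Pi.mul_apply, TwoCocycles.coboundary_apply, mul_right_comm,
      mul_right_comm _ (e g), div_mul_cancel, mul_comm (e g)]
  exact congrArg Units.val this

/-- Multiplying a cocycle by the coboundary of `e` amounts to replacing `U_g` by `e g U_g`. -/
noncomputable def coboundaryMulHom :
    CrossedProduct (TwoCocycles.coboundary e * α) →ₐ[k] CrossedProduct α :=
  lift _ (fun g => ofLinearMap α g ∘ₗ LinearMap.mulRight k (e g : L))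
    (by
      have he : ((TwoCocycles.coboundary e * α).1 (1, 1))⁻¹ * e 1 = (α.1 (1, 1))⁻¹ := by
        rw [Subgroup.coe_mul, Pi.mul_apply, TwoCocycles.coboundary_apply_one_one, mul_comm (e 1),
          mul_inv, inv_mul_cancel_right]
      exact congrArg (of α 1) (congrArg Units.val he))
    (fun g h x y => by
      have he := coboundary_mul_apply α e g h
      simp only [LinearMap.comp_apply, LinearMap.mulRight_apply, ofLinearMap, LinearMap.coe_mk,
        AddHom.coe_mk, of_mul_of, map_mul]
      congr 1
      linear_combination (-(x * g y)) * he)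

theorem coboundaryMulHom_of (g : Gal(L/k)) (x : L) :
    coboundaryMulHom α e (of _ g x) = of α g (x * e g) :=
  lift_of _ _ _ _ g x

theorem coboundaryMulHom_bijective : Function.Bijective (coboundaryMulHom α e) := by
  refine ⟨(coboundaryMulHom α e).toRingHom.injective, fun a => ?_⟩
  induction a using induction_of α with
  | h0 => exact ⟨0, map_zero _⟩
  | hadd a b ha hb =>
    obtain ⟨⟨a, rfl⟩, ⟨b, rfl⟩⟩ := And.intro ha hb
    exact ⟨a + b, map_add _ _ _⟩
  | hof g x =>
    exact ⟨of _ g (x / e g), by rw [coboundaryMulHom_of, div_mul_cancel₀ _ (e g).ne_zero]⟩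

end Cohomologous

theorem nonempty_algEquiv_of_cohomologyClass_eq {α β : TwoCocycles Gal(L/k) Lˣ}
    (h : cohomologyClass α = cohomologyClass β) :
    Nonempty (CrossedProduct α ≃ₐ[k] CrossedProduct β) := by
  obtain ⟨e, rfl⟩ := TwoCocycles.cohomologyClass_eq_iff.1 h
  exact ⟨(AlgEquiv.ofBijective _ (coboundaryMulHom_bijective α e)).symm⟩

theorem isBrauerEquivalent_csa_of_cohomologyClass_eq [FiniteDimensional k L] [IsGalois k L]
    {α β : TwoCocycles Gal(L/k) Lˣ} (h : cohomologyClass α = cohomologyClass β) :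
    IsBrauerEquivalent (csa α) (csa β) := by
  obtain ⟨f⟩ := nonempty_algEquiv_of_cohomologyClass_eq h
  exact ⟨1, 1, one_ne_zero, one_ne_zero, ⟨f.mapMatrix⟩⟩

section Inflation

variable (K : Type*) [Field K] [Algebra k K] [Algebra L K] [IsScalarTower k L K] [Normal k L]

theorem map_restrictNormalHom_smul (σ : Gal(K/k)) (x : Lˣ) :
    Units.map (algebraMap L K : L →* K) (AlgEquiv.restrictNormalHom L σ • x) =
      σ • Units.map (algebraMap L K : L →* K) x :=
  Units.ext (AlgEquiv.restrictNormal_commutes σ L x)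

/-- The inflation of 2-cocycles from `Gal(L/k)` to `Gal(K/k)`. -/
noncomputable def inflation : TwoCocycles Gal(L/k) Lˣ →* TwoCocycles Gal(K/k) Kˣ :=
  TwoCocycles.map (AlgEquiv.restrictNormalHom L) (Units.map (algebraMap L K : L →* K))
    (map_restrictNormalHom_smul K)

variable {K}

theorem coe_inflation_apply (α : TwoCocycles Gal(L/k) Lˣ) (σ τ : Gal(K/k)) :
    ((inflation K α).1 (σ, τ) : K) =
      algebraMap L K (α.1 (AlgEquiv.restrictNormalHom L σ, AlgEquiv.restrictNormalHom L τ)) := rfl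

variable (α : TwoCocycles Gal(L/k) Lˣ) {ι : Type*} (b : Module.Basis ι L K)

/-- The matrix by which `x U_σ` acts on `K ⊗[L] CrossedProduct α`, a free right module over
`CrossedProduct α` with basis `b`, through `y ⊗ a ↦ x * σ y ⊗ U_g a`, where `g` is the restriction
of `σ` to `L`. -/
noncomputable def inflationMatrix (σ : Gal(K/k)) : K →ₗ[k] Matrix ι ι (CrossedProduct α) where
  toFun x := Matrix.of fun i j =>
    of α (AlgEquiv.restrictNormalHom L σ) (b.repr (x * σ (b j)) i)
  map_add' x y := by
    ext1 i j
    simp only [Matrix.of_apply, Matrix.add_apply, ← of_add, add_mul, map_add, Finsupp.add_apply]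
  map_smul' c x := by
    ext1 i j
    simp only [Matrix.of_apply, Matrix.smul_apply, smul_of, RingHom.id_apply]
    rw [Algebra.smul_def, IsScalarTower.algebraMap_apply k L K, mul_assoc,
      basis_repr_algebraMap_mul, Algebra.smul_def]

theorem inflationMatrix_apply (σ : Gal(K/k)) (x : K) (i j : ι) :
    inflationMatrix α b σ x i j =
      of α (AlgEquiv.restrictNormalHom L σ) (b.repr (x * σ (b j)) i) := rfl

theorem inflationMatrix_one [DecidableEq ι] :
    inflationMatrix α b 1 (((inflation K α).1 (1, 1))⁻¹ : Kˣ) = 1 := by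
  ext1 i j
  rw [inflationMatrix_apply, Units.val_inv_eq_inv_val, coe_inflation_apply, map_one, ← map_inv₀,
    AlgEquiv.one_apply, basis_repr_algebraMap_mul, b.repr_self, ← Units.val_inv_eq_inv_val,
    Matrix.one_apply]
  split_ifs with hij
  · rw [hij, Finsupp.single_eq_same, mul_one, one_def]
  · rw [Finsupp.single_eq_of_ne hij, mul_zero, of_zero]

variable [Fintype ι]

theorem repr_mul_apply_eq_sum (σ : Gal(K/k)) (x y : K) (i : ι) :
    b.repr (x * σ y) i =
      ∑ j, b.repr (x * σ (b j)) i * AlgEquiv.restrictNormalHom L σ (b.repr y j) := by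
  have semilinear (c : L) (z : K) :
      x * σ (c • z) = algebraMap L K (AlgEquiv.restrictNormalHom L σ c) * (x * σ z) := by
    have hc : σ (algebraMap L K c) = algebraMap L K (AlgEquiv.restrictNormalHom L σ c) :=
      (AlgEquiv.restrictNormal_commutes σ L c).symm
    rw [Algebra.smul_def, map_mul, hc, mul_left_comm]
  conv_lhs => rw [← b.sum_repr y, map_sum, Finset.mul_sum, map_sum, Finsupp.finsetSum_apply]
  exact Finset.sum_congr rfl fun j _ => by rw [semilinear, basis_repr_algebraMap_mul, mul_comm]

theorem inflationMatrix_mul (σ τ : Gal(K/k)) (x y : K) :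
    inflationMatrix α b σ x * inflationMatrix α b τ y =
      inflationMatrix α b (σ * τ) (x * σ y * ((inflation K α).1 (σ, τ) : K)) := by
  ext1 i l
  simp only [Matrix.mul_apply, inflationMatrix_apply, of_mul_of, ← of_sum, ← Finset.sum_mul,
    ← repr_mul_apply_eq_sum, map_mul, coe_inflation_apply]
  rw [mul_comm (b.repr _ i), ← basis_repr_algebraMap_mul, AlgEquiv.mul_apply]
  congr 3
  ring

/-- The action of the crossed product of the inflation of `α` on `K ⊗[L] CrossedProduct α`, in
matrix form. -/
noncomputable def inflationHom [DecidableEq ι] :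
    CrossedProduct (inflation K α) →ₐ[k] Matrix ι ι (CrossedProduct α) :=
  lift _ (inflationMatrix α b) (inflationMatrix_one α b) (inflationMatrix_mul α b)

end Inflation

theorem inflationHom_bijective {K : Type*} [Field K] [Algebra k K] [Algebra L K]
    [IsScalarTower k L K] [IsGalois k L] [FiniteDimensional k K] [IsGalois k K]
    (α : TwoCocycles Gal(L/k) Lˣ) {ι : Type*} [Fintype ι] [DecidableEq ι]
    (b : Module.Basis ι L K) :
    Function.Bijective (inflationHom α b) := by
  have : FiniteDimensional k L := FiniteDimensional.left k L K
  have : Nonempty ι := b.index_nonempty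
  have hinj : Function.Injective (inflationHom α b) := (inflationHom α b).toRingHom.injective
  have hdim : Module.finrank k (CrossedProduct (inflation K α)) =
      Module.finrank k (Matrix ι ι (CrossedProduct α)) := by
    rw [Module.finrank_matrix, finrank_eq, finrank_eq, ← Module.finrank_eq_card_basis b,
      ← Module.finrank_mul_finrank k L K]
    ring
  exact ⟨hinj, (LinearMap.injective_iff_surjective_of_finrank_eq_finrank hdim
    (f := (inflationHom α b).toLinearMap)).1 hinj⟩

theorem isBrauerEquivalent_csa_inflation {K : Type v} [Field K] [Algebra k K] [Algebra L K]
    [IsScalarTower k L K] [FiniteDimensional k L] [IsGalois k L] [FiniteDimensional k K]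
    [IsGalois k K] (α : TwoCocycles Gal(L/k) Lˣ) :
    IsBrauerEquivalent (csa α) (csa (inflation K α)) := by
  have : FiniteDimensional L K := FiniteDimensional.right k L K
  let f := AlgEquiv.ofBijective _ (inflationHom_bijective α (Module.finBasis L K))
  obtain ⟨g⟩ := nonempty_matrix_fin_one_algEquiv k (CrossedProduct (inflation K α))
  exact ⟨Module.finrank L K, 1, Module.finrank_pos.ne', one_ne_zero, ⟨f.symm.trans g.symm⟩⟩

theorem exists_cohomologyClass_inflation_eq_pow_eq_one [FiniteDimensional k L] [IsGalois k L]
    {α : TwoCocycles Gal(L/k) Lˣ} {m : ℕ} (hm : (m : k) ≠ 0) (hα : cohomologyClass α ^ m = 1) :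
    ∃ (K : Type v) (_ : Field K) (_ : Algebra k K) (_ : Algebra L K) (_ : IsScalarTower k L K)
      (_ : FiniteDimensional k K) (_ : IsGalois k K) (β : TwoCocycles Gal(K/k) Kˣ),
      cohomologyClass (inflation K α) = cohomologyClass β ∧ β ^ m = 1 := by
  obtain ⟨c, hc⟩ : ∃ c, TwoCocycles.coboundary c = α ^ m := by
    rwa [← TwoCocycles.cohomologyClass_eq_one_iff, TwoCocycles.cohomologyClass_pow]
  obtain ⟨K, _, _, _, _, _, _, d, hd⟩ := exists_isGalois_forall_pow_eq (k := k) c hm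
  let x (σ : Gal(K/k)) : Kˣ := d (AlgEquiv.restrictNormalHom L σ)
  have hx : TwoCocycles.coboundary (x ^ m) = inflation K α ^ m := by
    rw [← map_pow, ← hc, inflation, TwoCocycles.map_coboundary]
    exact congrArg _ (funext fun σ => hd _)
  exact ⟨K, inferInstance, inferInstance, inferInstance, inferInstance, inferInstance,
    inferInstance, TwoCocycles.exists_cohomologyClass_eq_pow_eq_one hx⟩

end CrossedProduct

theorem mainTheorem5 {k : Type u} {L : Type v} [Field k] [Field L] [Algebra k L]
    [FiniteDimensional k L] [IsGalois k L]
    (α : TwoCocycles Gal(L/k) Lˣ) (m : ℕ) (hm : orderOf (cohomologyClass α) = m)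
    (hchar : ringChar k = 0 ∨ ¬ ringChar k ∣ m) :
    ∃ (K : Type v) (_ : Field K) (_ : Algebra k K) (_ : Algebra L K) (_ : IsScalarTower k L K)
      (_ : FiniteDimensional k K) (_ : IsGalois k K) (β : TwoCocycles Gal(K/k) Kˣ),
      IsFiniteCocycle β ∧ (∀ g h : Gal(K/k), β.1 (g, h) ^ m = 1) ∧
        IsBrauerEquivalent (CrossedProduct.csa α) (CrossedProduct.csa β) := by
  have hm_pos : 0 < m := hm ▸ (TwoCocycles.isOfFinOrder_cohomologyClass α).orderOf_pos
  have hmk : (m : k) ≠ 0 := by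
    rw [Ne, ringChar.spec]
    intro hdvd
    refine hchar.elim (fun h0 => hm_pos.ne' ?_) fun h => h hdvd
    rwa [h0, zero_dvd_iff] at hdvd
  obtain ⟨K, _, _, _, _, _, _, β, hβ, hβm⟩ :=
    CrossedProduct.exists_cohomologyClass_inflation_eq_pow_eq_one hmk
      (hm ▸ pow_orderOf_eq_one (cohomologyClass α))
  have hpow (g h : Gal(K/k)) : β.1 (g, h) ^ m = 1 := congrFun (congrArg Subtype.val hβm) (g, h)
  have hfinite : IsFiniteCocycle β := fun g h =>
    isOfFinOrder_iff_pow_eq_one.2 ⟨m, hm_pos, hpow g h⟩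
  exact ⟨K, inferInstance, inferInstance, inferInstance, inferInstance, inferInstance,
    inferInstance, β, hfinite, hpow,
    (CrossedProduct.isBrauerEquivalent_csa_inflation α).trans
      (CrossedProduct.isBrauerEquivalent_csa_of_cohomologyClass_eq hβ)⟩
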